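/- **Theorem (lower bound for \textsc{ApproxFreq}$(\epsilon)$).** *Streams.* A stream $\sigma$ over $[1,n]$ is a finite sequence of records $(i,\delta)$ with $i\in[1,n]$, $\delta\in\{+1,-1\}$. Its frequency vector $\mathrm{freq}\,\sigma\in\mathbb Z^n$ has coordinates $(\mathrm{freq}\,\sigma)_i=\sum_{(i,\delta)\in\sigma}\delta$, and its size is $|\sigma|=\max\{\|\mathrm{freq}\,\sigma'\|_\infty : \sigma' \text{ a prefix of } \sigma\}$. *Automata.* A stream automaton $A_n$ over $[1,n]$ is a deterministic Turing machine with a finite set $Q(A_n)$ of control states, a one-way read-only input tape that holds the stream (one record per cell, followed by an end marker), and a two-way read-write work-tape, infinite to the right and initially blank, each cell of which is blank or holds one bit. When the input head has moved past the last record of $\sigma$, the automaton has processed $\sigma$; it then works on the end marker until it halts, and the final contents of its work-tape denote, by some arbitrary fixed decoding convention, an output vector $\hat f\in\mathbb R^n$ (for instance in $\mathbb Z^n$). It solves \textsc{ApproxFreq}$(\epsilon)$ if, for every stream $\sigma$ over $[1,n]$ (of any size), it halts with an output $\hat f$ such that $|\hat f_i-(\mathrm{freq}\,\sigma)_i|\le\epsilon\,\|\mathrm{freq}\,\sigma\|_1$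 for all $i\in[1,n]$. *Space.* $A_n$ uses space $s=s(n,m)$ if, for every stream $\sigma$ with $|\sigma|\le m$, at the moment when $A_n$ has processed $\sigma$ the work head and all nonblank cells lie among the first $s$ cells of the work-tape (the space used afterwards, to compute and write the output, is not counted). The effective space usage is $$\mathrm{Space}(A_n,m)=s(n,m)+\log_2 s(n,m)+\log_2|Q(A_n)| .$$ *Claim.* There are absolute constants $c>0$ and $C$ such that for all $n\ge 1$, all real $\epsilon$ with $\frac1{24\sqrt n}\le\epsilon<\frac1{32}$, every stream automaton $A_n$ over $[1,n]$ that solves \textsc{ApproxFreq}$(\epsilon)$, every $m\ge1$ and every $s(n,m)$ such that $A_n$ uses space $s(n,m)$, $$\mathrm{Space}(A_n,m)\ \ge\ c\,\frac{\log_2 m}{\epsilon^2}-C\log_2 n .$$ -/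

import Mathlib

/-- A stream record over the domain `Fin n`: the pair `(i, 1)` inserts an instance of the item `i`,
the pair `(i, -1)` deletes one. -/
abbrev StreamRecord (n : ℕ) : Type := Fin n × ℤˣ

/-- The frequency vector of a stream. -/
def streamFreq {n : ℕ} (σ : List (StreamRecord n)) : Fin n → ℤ :=
  (σ.map fun r => (Pi.single r.1 (r.2 : ℤ) : Fin n → ℤ)).sum

/-- The size of a stream: the largest `ℓ_∞` norm of the frequency vector of one of its prefixes
(the prefixes of `σ` are the lists `σ.take k` with `k ≤ σ.length`). -/
def streamSize {n : ℕ} (σ : List (StreamRecord n)) : ℕ :=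
  (Finset.range (σ.length + 1)).sup fun k =>
    Finset.univ.sup fun i => (streamFreq (σ.take k) i).natAbs

/-- A cell of the work-tape is blank (`none`) or holds one bit. -/
abbrev WorkCell : Type := Option Bool

/-- The contents of a work-tape, whose cells are numbered `0, 1, 2, …`. -/
abbrev WorkTape : Type := ℕ → WorkCell

/-- Moves of the head of the work-tape. -/
inductive HeadMove : Type
  | left
  | stay
  | right

/-- The new position of the head; a left move in the leftmost cell leaves the head there. -/
def HeadMove.apply : HeadMove → ℕ → ℕ
  | .left, h => h - 1
  | .stay, h => h
  | .right, h => h + 1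

/-- What a machine with set of states `Q` does in one step: it enters a state, writes a symbol in
the scanned work cell, moves the work head and, if `advance` is `true`, moves the input head to the
next input cell. -/
structure MachineAction (Q : Type) where
  state : Q
  write : WorkCell
  move : HeadMove
  advance : Bool

/-- A stream automaton over a domain of `n` items: a deterministic Turing machine with a finite
control, a one-way read-only input tape and a two-way read-write work-tape. An input cell holds a
stream record (`some r`), and the stream is followed by an end marker (`none`). The value `none` of
the transition function means that the machine halts. -/
structure StreamAutomaton (n : ℕ) where
  Q : Type
  finite_Q : Finite Q
  start : Q
  trans : Q → Option (StreamRecord n) → WorkCell → Option (MachineAction Q)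

namespace StreamAutomaton

variable {n : ℕ}

/-- A configuration: the state of the finite control, the position of the head on the work-tape and
the contents of the work-tape. -/
structure Config (A : StreamAutomaton n) where
  state : A.Q
  head : ℕ
  tape : WorkTape

/-- The initial configuration: start state, head in cell `0`, blank work-tape. -/
def init (A : StreamAutomaton n) : A.Config := ⟨A.start, 0, fun _ => none⟩

/-- The action of the automaton in the configuration `c` when its input head scans `x`. -/
def actionAt (A : StreamAutomaton n) (x : Option (StreamRecord n)) (c : A.Config) :
    Option (MachineAction A.Q) :=
  A.trans c.state x (c.tape c.head)

/-- The configuration that results from an action. -/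
def perform (A : StreamAutomaton n) (c : A.Config) (a : MachineAction A.Q) : A.Config :=
  ⟨a.state, a.move.apply c.head, Function.update c.tape c.head a.write⟩

/-- One step during which the input head stays on the record `r`. -/
def WorkStep (A : StreamAutomaton n) (r : StreamRecord n) (c d : A.Config) : Prop :=
  ∃ a, A.actionAt (some r) c = some a ∧ a.advance = false ∧ d = A.perform c a

/-- One step during which the input head leaves the record `r`. -/
def AdvanceStep (A : StreamAutomaton n) (r : StreamRecord n) (c d : A.Config) : Prop :=
  ∃ a, A.actionAt (some r) c = some a ∧ a.advance = true ∧ d = A.perform c a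

/-- One step on the end marker, which the input head cannot leave. -/
def EndStep (A : StreamAutomaton n) (c d : A.Config) : Prop :=
  ∃ a, A.actionAt none c = some a ∧ d = A.perform c a

/-- Processing of one record `r`: from `c`, after finitely many steps on `r`, the input head moves
past `r`, and at that moment the configuration is `d`. This is the graph of the (partial)
transition function `c ⊕ r = d`. -/
def Transition (A : StreamAutomaton n) (c : A.Config) (r : StreamRecord n) (d : A.Config) : Prop :=
  ∃ b, Relation.ReflTransGen (A.WorkStep r) c b ∧ A.AdvanceStep r b d

/-- `A.Reaches σ c`: started in the initial configuration, the automaton processes the stream `σ`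
and is then in the configuration `c`. -/
inductive Reaches (A : StreamAutomaton n) : List (StreamRecord n) → A.Config → Prop
  | nil : Reaches A [] A.init
  | snoc {σ : List (StreamRecord n)} {c d : A.Config} (r : StreamRecord n) :
      Reaches A σ c → A.Transition c r d → Reaches A (σ ++ [r]) d

/-- `A.HaltsWith σ w`: after having processed the stream `σ`, the automaton works on the end marker
and halts, and the contents of the work-tape are then `w`. -/
def HaltsWith (A : StreamAutomaton n) (σ : List (StreamRecord n)) (w : WorkTape) : Prop :=
  ∃ c d : A.Config, A.Reaches σ c ∧ Relation.ReflTransGen A.EndStep c d ∧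
    A.actionAt none d = none ∧ d.tape = w

/-- The automaton solves the problem of estimating all frequencies within `ε` times the `ℓ₁` norm:
on every stream `σ` it halts, and the vector `dec w` that is written on its work-tape differs from
the frequency vector of `σ` by at most `ε ‖freq σ‖₁` in each coordinate. Here `dec` is the
convention by which the contents of a work-tape denote a vector. -/
def SolvesApproxFreq (A : StreamAutomaton n) (dec : WorkTape → Fin n → ℝ) (ε : ℝ) : Prop :=
  ∀ σ : List (StreamRecord n), ∃ w : WorkTape, A.HaltsWith σ w ∧
    ∀ i, |dec w i - (streamFreq σ i : ℝ)| ≤ ε * ∑ j, |(streamFreq σ j : ℝ)|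

/-- In the configuration `c` at most the first `s` cells of the work-tape are in use: the head and
all nonblank cells are among them. -/
def Config.FitsIn {A : StreamAutomaton n} (c : A.Config) (s : ℕ) : Prop :=
  c.head < s ∧ ∀ k, s ≤ k → c.tape k = none

/-- The automaton uses space at most `s` on streams of size at most `m`: after having processed any
such stream, at most `s` cells of the work-tape are in use. -/
def UsesSpace (A : StreamAutomaton n) (m s : ℕ) : Prop :=
  ∀ σ : List (StreamRecord n), streamSize σ ≤ m → ∀ c : A.Config, A.Reaches σ c → c.FitsIn s

/-- The effective space usage `s + log s + log |Q|` (in bits) of an automaton that uses `s` cells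
of its work-tape. -/
noncomputable def effectiveSpace (A : StreamAutomaton n) (s : ℕ) : ℝ :=
  (s : ℝ) + Real.logb 2 (s : ℝ) + Real.logb 2 (Nat.card A.Q : ℝ)

end StreamAutomaton

/-! ### Streams, recurrent states and the lattice of invisible shifts. -/

section Streams

variable {n : ℕ}

/-! The automaton cannot distinguish frequency vectors that differ by certain lattice vectors.
Choose a stream `σ` of size at most `m` from which every continuation within size `m` can return to
the frequencies and state of `σ` (`exists_recurrent_stream`). If two continuations within the box
end in the same state, then following one of them and returning as from the other shifts the
frequencies but not the state; such shifts form a lattice `L` (`exists_lattice`). A stream with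
frequency zero must be estimated exactly, so a vector of `L`, being confused with zero, has all
coordinates at most `ε` times its `ℓ₁` norm.

Restrict `L` to the first `k` coordinates, with `k` of order `ε⁻²`. The bound passes to the real
span, whose dimension is then at most `ε²k² ≤ k/2` (`finrank_le_of_abs_apply_le`). So at least `k/2`
coordinates are independent modulo the lattice, and the vectors supported there with entries in `0,
…, m` need pairwise different configurations (`exists_pow_le_ncard`). Comparing with the number of
configurations that fit in `s` cells gives the bound. -/

theorem streamFreq_nil : streamFreq ([] : List (StreamRecord n)) = 0 := by
  simp [streamFreq]

theorem streamFreq_append (σ τ : List (StreamRecord n)) :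
    streamFreq (σ ++ τ) = streamFreq σ + streamFreq τ := by
  simp [streamFreq]

theorem streamFreq_singleton (r : StreamRecord n) :
    streamFreq [r] = Pi.single r.1 (r.2 : ℤ) := by
  simp [streamFreq]

theorem streamSize_le_iff {σ : List (StreamRecord n)} {m : ℕ} :
    streamSize σ ≤ m ↔ ∀ k ≤ σ.length, ∀ i, (streamFreq (σ.take k) i).natAbs ≤ m := by
  simp [streamSize, Finset.sup_le_iff]

theorem streamSize_nil : streamSize ([] : List (StreamRecord n)) = 0 :=
  Nat.le_zero.1 <| streamSize_le_iff.2 fun k _ i => by simp [streamFreq_nil]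

theorem natAbs_streamFreq_le {σ : List (StreamRecord n)} {m : ℕ} (h : streamSize σ ≤ m)
    (i : Fin n) : (streamFreq σ i).natAbs ≤ m := by
  simpa using streamSize_le_iff.1 h σ.length le_rfl i

theorem streamSize_append_singleton_le {σ : List (StreamRecord n)} {r : StreamRecord n} {m : ℕ}
    (h : streamSize σ ≤ m) (hr : ∀ i, (streamFreq (σ ++ [r]) i).natAbs ≤ m) :
    streamSize (σ ++ [r]) ≤ m := by
  refine streamSize_le_iff.2 fun k hk i => ?_
  rcases Nat.lt_or_ge σ.length k with hlt | hle
  · rw [List.take_of_length_le (by simp; omega)]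
    exact hr i
  · rw [List.take_append_of_le_length hle]
    exact streamSize_le_iff.1 h k hle i

/-- Within the box of radius `m` every frequency vector can be reached from every stream. -/
theorem exists_append_streamFreq_eq {m : ℕ} (f : Fin n → ℤ) (hf : ∀ i, (f i).natAbs ≤ m)
    (σ : List (StreamRecord n)) (hσ : streamSize σ ≤ m) :
    ∃ ρ, streamSize (σ ++ ρ) ≤ m ∧ streamFreq (σ ++ ρ) = f := by
  induction hN : ∑ i, (f i - streamFreq σ i).natAbs using Nat.strong_induction_on generalizing σ
  next N ih =>
    by_cases heq : streamFreq σ = f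
    · exact ⟨[], by simpa using hσ, by simpa using heq⟩
    obtain ⟨i, hi⟩ := Function.ne_iff.1 heq
    obtain ⟨u, hu1, hu2⟩ : ∃ u : ℤˣ, (streamFreq σ i + u).natAbs ≤ m ∧
        (f i - (streamFreq σ i + u)).natAbs < (f i - streamFreq σ i).natAbs := by
      have h1 := hf i
      have h2 := natAbs_streamFreq_le hσ i
      rcases lt_or_gt_of_ne hi with h | h
      · exact ⟨1, by simp; omega, by simp; omega⟩
      · exact ⟨-1, by simp; omega, by simp; omega⟩
    have hfreq : ∀ j, streamFreq (σ ++ [(i, u)]) j =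
        if j = i then streamFreq σ i + u else streamFreq σ j := by
      intro j
      rw [streamFreq_append, streamFreq_singleton, Pi.add_apply, Pi.single_apply]
      split_ifs with h <;> simp [h]
    have hsize : streamSize (σ ++ [(i, u)]) ≤ m := by
      refine streamSize_append_singleton_le hσ fun j => ?_
      rw [hfreq]
      split_ifs
      · exact hu1
      · exact natAbs_streamFreq_le hσ j
    obtain ⟨ρ, h1, h2⟩ := ih _ (by
      rw [← hN]
      refine Finset.sum_lt_sum (fun j _ => ?_) ⟨i, Finset.mem_univ i, ?_⟩
      · rw [hfreq]
        split_ifs with h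
        · subst h; exact hu2.le
        · exact le_rfl
      · rw [hfreq, if_pos rfl]; exact hu2) _ hsize rfl
    exact ⟨(i, u) :: ρ, by simpa using h1, by simpa using h2⟩

theorem exists_streamFreq_eq (f : Fin n → ℤ) : ∃ σ, streamFreq σ = f := by
  obtain ⟨ρ, -, h⟩ := exists_append_streamFreq_eq (m := Finset.univ.sup fun i => (f i).natAbs) f
    (fun i => Finset.le_sup (f := fun i => (f i).natAbs) (Finset.mem_univ i)) []
    (by simp [streamSize_nil])
  exact ⟨[] ++ ρ, h⟩

variable {X : Type*}

/-- The states with frequencies that can be reached by prolonging `σ` within size `m`. -/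
def continuations (run : List (StreamRecord n) → X) (m : ℕ) (σ : List (StreamRecord n)) :
    Set ((Fin n → ℤ) × X) :=
  {p | ∃ ρ, streamSize (σ ++ ρ) ≤ m ∧ (streamFreq (σ ++ ρ), run (σ ++ ρ)) = p}

/-- A stream after which, whatever happens within size `m`, one can return to the present
frequencies and state. -/
theorem exists_recurrent_stream (run : List (StreamRecord n) → X) (m : ℕ) {Y : Set X}
    (hY : Y.Finite) (hrun : ∀ σ, streamSize σ ≤ m → run σ ∈ Y) :
    ∃ σ, streamSize σ ≤ m ∧ ∀ ρ, streamSize (σ ++ ρ) ≤ m →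
      ∃ ρ', streamFreq (σ ++ ρ ++ ρ') = streamFreq σ ∧ run (σ ++ ρ ++ ρ') = run σ := by
  have hfin : ∀ σ, (continuations run m σ).Finite := fun σ => by
    refine Set.Finite.subset ((Set.finite_Icc (fun _ : Fin n => -(m : ℤ)) fun _ => (m : ℤ)).prod hY)
      ?_
    rintro _ ⟨ρ, hρ, rfl⟩
    refine ⟨⟨fun i => ?_, fun i => ?_⟩, hrun _ hρ⟩ <;>
    · have := natAbs_streamFreq_le hρ i
      simp only
      omega
  -- Prolonging a stream can only shrink its finite set of continuations. When that set is smallest,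
  -- nothing is lost, and the present pair stays reachable.
  obtain ⟨σ, hσ, hmin⟩ := exists_minimalFor_of_wellFoundedLT
    (fun σ : List (StreamRecord n) => streamSize σ ≤ m)
    (fun σ => (continuations run m σ).ncard) ⟨[], by simp [streamSize_nil]⟩
  refine ⟨σ, hσ, fun ρ hρ => ?_⟩
  have hsub : continuations run m (σ ++ ρ) ⊆ continuations run m σ := by
    rintro _ ⟨ρ', h, rfl⟩
    exact ⟨ρ ++ ρ', by simpa using h, by simp⟩
  have heq := Set.eq_of_subset_of_ncard_le hsub
    (hmin hρ (Set.ncard_le_ncard hsub (hfin σ))) (hfin σ)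
  have hmem : (streamFreq σ, run σ) ∈ continuations run m σ := ⟨[], by simpa using hσ, by simp⟩
  rw [← heq] at hmem
  obtain ⟨ρ', -, h⟩ := hmem
  exact ⟨ρ', congrArg Prod.fst h, congrArg Prod.snd h⟩

/-- The vectors by which the frequencies can be changed, in either direction, without leaving the
state `c`. -/
def invisibleShifts (run : List (StreamRecord n) → X) (c : X) : AddSubgroup (Fin n → ℤ) where
  carrier := {x | ∀ τ, run τ = c →
    (∃ τ', run τ' = c ∧ streamFreq τ' = streamFreq τ + x) ∧
    ∃ τ', run τ' = c ∧ streamFreq τ' = streamFreq τ - x}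
  zero_mem' := fun τ hτ => ⟨⟨τ, hτ, by simp⟩, τ, hτ, by simp⟩
  neg_mem' := fun {x} hx τ hτ => by
    obtain ⟨h1, h2⟩ := hx τ hτ
    exact ⟨by simpa [sub_eq_add_neg] using h2, by simpa using h1⟩
  add_mem' := fun {x y} hx hy τ hτ => by
    obtain ⟨⟨τ₁, h1, e1⟩, τ₂, h2, e2⟩ := hx τ hτ
    obtain ⟨⟨τ₃, h3, e3⟩, -⟩ := hy τ₁ h1
    obtain ⟨-, τ₄, h4, e4⟩ := hy τ₂ h2
    exact ⟨⟨τ₃, h3, by rw [e3, e1]; abel⟩, τ₄, h4, by rw [e4, e2]; abel⟩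

/-- A deterministic device that estimates all frequencies has a lattice of frequency vectors that it
confuses with zero, and its states of size `m` separate the box modulo that lattice. -/
theorem exists_lattice (run : List (StreamRecord n) → X)
    (hcongr : ∀ σ τ ρ, run σ = run τ → run (σ ++ ρ) = run (τ ++ ρ))
    (out : X → Fin n → ℝ) (ε : ℝ)
    (hout : ∀ σ i, |out (run σ) i - (streamFreq σ i : ℝ)| ≤ ε * ∑ j, |(streamFreq σ j : ℝ)|)
    (m : ℕ) {Y : Set X} (hY : Y.Finite) (hrun : ∀ σ, streamSize σ ≤ m → run σ ∈ Y) :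
    ∃ L : AddSubgroup (Fin n → ℤ),
      (∀ x ∈ L, ∀ i, |(x i : ℝ)| ≤ ε * ∑ j, |(x j : ℝ)|) ∧
      ∃ g : (Fin n → ℤ) → X, ∀ f, (∀ i, (f i).natAbs ≤ m) → g f ∈ Y ∧
        ∀ f', (∀ i, (f' i).natAbs ≤ m) → g f = g f' → f - f' ∈ L := by
  obtain ⟨σ, hσ, hret⟩ := exists_recurrent_stream run m hY hrun
  -- Follow `ρ₁`, then return by the path `ρ'` made for `ρ₂`: the states agree, while `ρ'` only
  -- undoes the frequencies of `ρ₂`.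
  have hshift : ∀ ρ₁ ρ₂, streamSize (σ ++ ρ₂) ≤ m → run (σ ++ ρ₁) = run (σ ++ ρ₂) →
      ∀ τ, run τ = run σ → ∃ τ', run τ' = run σ ∧
        streamFreq τ' = streamFreq τ + (streamFreq (σ ++ ρ₁) - streamFreq (σ ++ ρ₂)) := by
    intro ρ₁ ρ₂ h₂ h τ hτ
    obtain ⟨ρ', hf, hr⟩ := hret ρ₂ h₂
    refine ⟨τ ++ ρ₁ ++ ρ', ?_, ?_⟩
    · rw [← hr]
      exact hcongr _ _ _ ((hcongr _ _ _ hτ).trans h)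
    · simp only [streamFreq_append] at hf ⊢
      rw [show streamFreq ρ' = -streamFreq ρ₂ by
        rw [add_assoc, add_eq_left, add_comm] at hf
        exact eq_neg_of_add_eq_zero_left hf]
      abel
  refine ⟨invisibleShifts run (run σ), fun x hx i => ?_, ?_⟩
  · obtain ⟨⟨τ, hτ, hfτ⟩, -⟩ := hx σ rfl
    -- Cancelling `σ` by `ν` leaves frequency `0` on one side and `x` on the other, with a common
    -- output, which must be exactly `0`. The size of `ν` is not bounded, so correctness beyond size
    -- `m` is used here.
    obtain ⟨ν, hν⟩ := exists_streamFreq_eq (-streamFreq σ)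
    have h0 := hout (σ ++ ν) i
    have h1 := hout (τ ++ ν) i
    rw [hcongr τ σ ν hτ] at h1
    have e0 : streamFreq (σ ++ ν) = 0 := by rw [streamFreq_append, hν]; simp
    have e1 : streamFreq (τ ++ ν) = x := by rw [streamFreq_append, hν, hfτ]; abel
    rw [e0] at h0
    rw [e1] at h1
    have h2 : out (run (σ ++ ν)) i = 0 := by simpa using h0
    simpa [h2] using h1
  · choose ρ hρ1 hρ2 using fun f : {f : Fin n → ℤ // ∀ i, (f i).natAbs ≤ m} =>
      exists_append_streamFreq_eq f.1 f.2 σ hσ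
    classical
    refine ⟨fun f => if h : ∀ i, (f i).natAbs ≤ m then run (σ ++ ρ ⟨f, h⟩) else run σ,
      fun f hf => ⟨?_, fun f' hf' h => ?_⟩⟩
    · simp only [dif_pos hf]
      exact hrun _ (hρ1 _)
    · simp only [dif_pos hf, dif_pos hf'] at h
      have e1 := hρ2 ⟨f, hf⟩
      have e2 := hρ2 ⟨f', hf'⟩
      intro τ hτ
      have k1 := hshift _ _ (hρ1 _) h τ hτ
      have k2 := hshift _ _ (hρ1 _) h.symm τ hτ
      rw [e1, e2] at k1 k2
      exact ⟨k1, by simpa [sub_eq_add_neg] using k2⟩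

end Streams

/-! ### Determinism of the automaton and the number of its configurations. -/

namespace StreamAutomaton

variable {n : ℕ} {A : StreamAutomaton n}

/-- Two runs of a deterministic relation that end in dead ends end in the same point. -/
theorem reflTransGen_deadEnd_unique {α : Type*} {r : α → α → Prop}
    (hr : ∀ a b c, r a b → r a c → b = c) {a b c : α} (hab : Relation.ReflTransGen r a b)
    (hac : Relation.ReflTransGen r a c) (hb : ∀ d, ¬ r b d) (hc : ∀ d, ¬ r c d) : b = c := by
  induction hab using Relation.ReflTransGen.head_induction_on with
  | refl =>
    rcases hac.cases_head with h | ⟨d, hd, -⟩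
    · exact h
    · exact absurd hd (hb d)
  | head h _ ih =>
    rcases hac.cases_head with rfl | ⟨d, hd, hdc⟩
    · exact absurd h (hc _)
    · obtain rfl := hr _ _ _ h hd
      exact ih hdc

theorem Transition.unique {c d d' : A.Config} {r : StreamRecord n} (h : A.Transition c r d)
    (h' : A.Transition c r d') : d = d' := by
  obtain ⟨b, hb, a, ha, had, rfl⟩ := h
  obtain ⟨b', hb', a', ha', had', rfl⟩ := h'
  have dead : ∀ (b : A.Config) (a : MachineAction A.Q), A.actionAt (some r) b = some a →
      a.advance = true → ∀ d, ¬ A.WorkStep r b d := by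
    rintro b a h1 h2 d ⟨a', h3, h4, -⟩
    rw [h1, Option.some.injEq] at h3
    rw [h3, h4] at h2
    exact Bool.false_ne_true h2
  obtain rfl : b = b' := by
    refine reflTransGen_deadEnd_unique ?_ hb hb' (dead b a ha had) (dead b' a' ha' had')
    rintro x y z ⟨a₁, h1, -, rfl⟩ ⟨a₂, h2, -, rfl⟩
    rw [h1, Option.some.injEq] at h2
    rw [h2]
  rw [ha, Option.some.injEq] at ha'
  rw [ha']

theorem Reaches.exists_of_append_singleton {σ : List (StreamRecord n)} {r : StreamRecord n}
    {d : A.Config} (h : A.Reaches (σ ++ [r]) d) : ∃ c, A.Reaches σ c ∧ A.Transition c r d := by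
  generalize hτ : σ ++ [r] = τ at h
  cases h with
  | nil => simp at hτ
  | snoc r' hc ht =>
    obtain ⟨rfl, h2⟩ := List.append_inj' hτ rfl
    obtain rfl : r = r' := by simpa using h2
    exact ⟨_, hc, ht⟩

theorem Reaches.unique {σ : List (StreamRecord n)} {c d : A.Config} (hc : A.Reaches σ c)
    (hd : A.Reaches σ d) : c = d := by
  induction hc generalizing d with
  | nil =>
    generalize hτ : ([] : List (StreamRecord n)) = τ at hd
    cases hd with
    | nil => rfl
    | snoc => simp at hτ
  | snoc r _ ht ih =>
    obtain ⟨c', hc', ht'⟩ := hd.exists_of_append_singleton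
    obtain rfl := ih hc'
    exact ht.unique ht'

/-- A transition depends only on the configuration and the record, so the two runs coincide from `c`
on; `htot` ensures that no record blocks them. -/
theorem Reaches.append_congr (htot : ∀ σ, ∃ c, A.Reaches σ c) {σ τ : List (StreamRecord n)}
    {c : A.Config} (hσ : A.Reaches σ c) (hτ : A.Reaches τ c) (ρ : List (StreamRecord n)) :
    ∃ d, A.Reaches (σ ++ ρ) d ∧ A.Reaches (τ ++ ρ) d := by
  induction ρ using List.reverseRecOn with
  | nil => exact ⟨c, by simpa using hσ, by simpa using hτ⟩
  | append_singleton ρ r ih =>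
    obtain ⟨d, h1, h2⟩ := ih
    obtain ⟨e, he⟩ := htot (σ ++ ρ ++ [r])
    obtain ⟨d', hd', ht⟩ := he.exists_of_append_singleton
    obtain rfl := h1.unique hd'
    refine ⟨e, ?_, ?_⟩ <;> rw [← List.append_assoc]
    · exact he
    · exact h2.snoc r ht

/-- On the end marker the automaton halts, if at all, with a work-tape that is determined by the
configuration. -/
theorem endStep_tape_unique {c d d' : A.Config} (h : Relation.ReflTransGen A.EndStep c d)
    (hd : A.actionAt none d = none) (h' : Relation.ReflTransGen A.EndStep c d')
    (hd' : A.actionAt none d' = none) : d = d' := by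
  refine reflTransGen_deadEnd_unique ?_ h h' ?_ ?_
  · rintro x y z ⟨a₁, h1, rfl⟩ ⟨a₂, h2, rfl⟩
    rw [h1, Option.some.injEq] at h2
    rw [h2]
  · rintro e ⟨a, ha, -⟩
    simp [hd] at ha
  · rintro e ⟨a, ha, -⟩
    simp [hd'] at ha

/-- An automaton that solves the problem, seen as a map from streams to configurations together with
a map from configurations to estimates. -/
theorem SolvesApproxFreq.exists_run {dec : WorkTape → Fin n → ℝ} {ε : ℝ}
    (h : A.SolvesApproxFreq dec ε) :
    ∃ (run : List (StreamRecord n) → A.Config) (out : A.Config → Fin n → ℝ),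
      (∀ σ, A.Reaches σ (run σ)) ∧
      (∀ σ τ ρ, run σ = run τ → run (σ ++ ρ) = run (τ ++ ρ)) ∧
      ∀ σ i, |out (run σ) i - (streamFreq σ i : ℝ)| ≤ ε * ∑ j, |(streamFreq σ j : ℝ)| := by
  choose w hw hε using h
  choose run fin hrun hfin hhalt htape using hw
  have hcongr : ∀ σ τ ρ, run σ = run τ → run (σ ++ ρ) = run (τ ++ ρ) := fun σ τ ρ he => by
    obtain ⟨d, h1, h2⟩ := (hrun σ).append_congr (fun σ => ⟨_, hrun σ⟩) (he ▸ hrun τ) ρ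
    exact ((hrun _).unique h1).trans (h2.unique (hrun _))
  classical
  refine ⟨run, fun c => if hc : ∃ σ, run σ = c then dec (w hc.choose) else 0, hrun, hcongr,
    fun σ i => ?_⟩
  have hc : ∃ τ, run τ = run σ := ⟨σ, rfl⟩
  -- The chosen stream may differ from `σ`, but the final tape depends only on the shared
  -- configuration.
  have : w hc.choose = w σ := by
    rw [← htape, ← htape σ]
    congr 1
    refine endStep_tape_unique (hfin _) (hhalt _) ?_ (hhalt σ)
    rw [hc.choose_spec]
    exact hfin σ
  simp only [dif_pos hc, this]
  exact hε σ i

/-- The data that determine a configuration which fits in `s` cells. -/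
def Config.code (A : StreamAutomaton n) (s : ℕ) (c : {c : A.Config // c.FitsIn s}) :
    A.Q × Fin s × (Fin s → WorkCell) :=
  (c.1.state, ⟨c.1.head, c.2.1⟩, fun k => c.1.tape k)

theorem Config.code_injective (A : StreamAutomaton n) (s : ℕ) :
    Function.Injective (Config.code A s) := by
  rintro ⟨⟨q, h, t⟩, hc⟩ ⟨⟨q', h', t'⟩, hc'⟩ he
  simp only [Config.code, Prod.mk.injEq, Fin.mk.injEq] at he
  obtain ⟨rfl, rfl, ht⟩ := he
  congr
  funext k
  rcases Nat.lt_or_ge k s with hk | hk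
  · exact congrFun ht ⟨k, hk⟩
  · exact (hc.2 k hk).trans (hc'.2 k hk).symm

theorem finite_fitsIn (A : StreamAutomaton n) (s : ℕ) : {c : A.Config | c.FitsIn s}.Finite :=
  have := A.finite_Q
  Set.finite_coe_iff.1 (Finite.of_injective _ (Config.code_injective A s))

theorem ncard_fitsIn_le (A : StreamAutomaton n) (s : ℕ) :
    {c : A.Config | c.FitsIn s}.ncard ≤ Nat.card A.Q * (s * 3 ^ s) := by
  have := A.finite_Q
  refine (Nat.card_le_card_of_injective _ (Config.code_injective A s)).trans_eq ?_
  simp [Nat.card_prod, Nat.card_eq_fintype_card, Fintype.card_option]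

end StreamAutomaton

/-! ### Dimension of lattices whose vectors are spread over many coordinates. -/

section Lattices

variable {ι : Type*} [Fintype ι]

/-- The real subspace spanned by a lattice of integer vectors. -/
def realSpan (L : AddSubgroup (ι → ℤ)) : Submodule ℝ (EuclideanSpace ℝ ι) :=
  Submodule.span ℝ {v | ∃ y ∈ L, ∀ i, v i = (y i : ℝ)}

/-- Rounding the coefficients of a real combination of lattice vectors costs a bounded error,
uniformly in the scale `t`. -/
theorem exists_lattice_near_smul {L : AddSubgroup (ι → ℤ)} {v : EuclideanSpace ℝ ι}
    (hv : v ∈ realSpan L) : ∃ C : ℝ, ∀ t : ℝ, ∃ y ∈ L, ∀ i, |t * v i - (y i : ℝ)| ≤ C := by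
  induction hv using Submodule.span_induction with
  | mem v hv =>
    obtain ⟨y, hy, hvy⟩ := hv
    refine ⟨∑ j, |(y j : ℝ)|, fun t => ⟨round t • y, L.zsmul_mem hy _, fun i => ?_⟩⟩
    have h1 : |t - round t| ≤ 1 := (abs_sub_round t).trans (by norm_num)
    calc |t * v i - ((round t • y) i : ℤ)| = |t - round t| * |(y i : ℝ)| := by
          rw [hvy, ← abs_mul]
          simp [sub_mul]
      _ ≤ 1 * |(y i : ℝ)| := by gcongr
      _ ≤ ∑ j, |(y j : ℝ)| := by
          rw [one_mul]
          exact Finset.single_le_sum (f := fun j => |(y j : ℝ)|) (fun j _ => abs_nonneg _)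
            (Finset.mem_univ i)
  | zero => exact ⟨0, fun t => ⟨0, L.zero_mem, fun i => by simp⟩⟩
  | add v w _ _ hv hw =>
    obtain ⟨C, hC⟩ := hv
    obtain ⟨D, hD⟩ := hw
    refine ⟨C + D, fun t => ?_⟩
    obtain ⟨y, hy, h1⟩ := hC t
    obtain ⟨z, hz, h2⟩ := hD t
    refine ⟨y + z, L.add_mem hy hz, fun i => ?_⟩
    calc |t * (v + w) i - ((y + z) i : ℤ)|
        = |(t * v i - y i) + (t * w i - z i)| := by
          congr 1
          simp
          ring
      _ ≤ C + D := (abs_add_le _ _).trans (add_le_add (h1 i) (h2 i))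
  | smul a v _ hv =>
    obtain ⟨C, hC⟩ := hv
    refine ⟨C, fun t => ?_⟩
    obtain ⟨y, hy, h⟩ := hC (t * a)
    exact ⟨y, hy, fun i => by simpa [mul_assoc] using h i⟩

/-- A bound of coordinates by the `ℓ₁` norm passes from a lattice to its real span. -/
theorem abs_apply_le_of_mem_realSpan {L : AddSubgroup (ι → ℤ)} {ε : ℝ} (hε : 0 ≤ ε)
    (hL : ∀ y ∈ L, ∀ i, |(y i : ℝ)| ≤ ε * ∑ j, |(y j : ℝ)|) {v : EuclideanSpace ℝ ι}
    (hv : v ∈ realSpan L) (i : ι) : |v i| ≤ ε * ∑ j, |v j| := by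
  obtain ⟨C, hC⟩ := exists_lattice_near_smul hv
  by_contra! hlt
  -- A violation at `v` would grow linearly with `t`, whereas the lattice point near `t * v` keeps
  -- it below `D`.
  set D : ℝ := C + ε * (Fintype.card ι * C)
  have key : ∀ t : ℝ, 0 ≤ t → t * (|v i| - ε * ∑ j, |v j|) ≤ D := fun t ht => by
    obtain ⟨y, hy, h⟩ := hC t
    have h1 : t * |v i| ≤ |(y i : ℝ)| + C := by
      have := abs_sub_abs_le_abs_sub (t * v i) (y i)
      rw [abs_mul, abs_of_nonneg ht] at this
      linarith [h i]
    have h2 : ∑ j, |(y j : ℝ)| ≤ t * ∑ j, |v j| + Fintype.card ι * C := by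
      calc ∑ j, |(y j : ℝ)| ≤ ∑ j, (t * |v j| + C) := by
            refine Finset.sum_le_sum fun j _ => ?_
            have := abs_sub_abs_le_abs_sub (y j : ℝ) (t * v j)
            rw [abs_mul, abs_of_nonneg ht, abs_sub_comm] at this
            linarith [h j]
        _ = t * ∑ j, |v j| + Fintype.card ι * C := by
            rw [Finset.sum_add_distrib, ← Finset.mul_sum]
            simp
    have h3 := (hL y hy i).trans (mul_le_mul_of_nonneg_left h2 hε)
    simp only [D]
    linarith
  have hpos : 0 < |v i| - ε * ∑ j, |v j| := sub_pos.2 hlt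
  have h := key ((|D| + 1) / (|v i| - ε * ∑ j, |v j|)) (by positivity)
  rw [div_mul_cancel₀ _ hpos.ne'] at h
  linarith [le_abs_self D]

/-- A subspace in which every coordinate is bounded by `ε` times the `ℓ₁` norm has small dimension. -/
theorem finrank_le_of_abs_apply_le (V : Submodule ℝ (EuclideanSpace ℝ ι)) {ε : ℝ}
    (hV : ∀ v ∈ V, ∀ i, |v i| ≤ ε * ∑ j, |v j|) :
    (Module.finrank ℝ V : ℝ) ≤ ε ^ 2 * (Fintype.card ι : ℝ) ^ 2 := by
  classical
  set b := EuclideanSpace.basisFun ι ℝ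
  -- The dimension is the trace of the orthogonal projection. Each diagonal entry `x i`, with `x`
  -- the projection of a basis vector, equals `‖x‖²`; the hypothesis and Cauchy–Schwarz give `(x i)²
  -- ≤ ε² * card ι * x i`.
  have hproj : LinearMap.IsProj V (V.starProjection : EuclideanSpace ℝ ι →ₗ[ℝ] _) :=
    ⟨fun x => V.starProjection_apply_mem x, fun x hx => V.starProjection_eq_self_iff.2 hx⟩
  have htrace := hproj.trace
  rw [LinearMap.trace_eq_sum_inner _ b] at htrace
  rw [← htrace]
  calc _ ≤ ∑ _i : ι, ε ^ 2 * (Fintype.card ι : ℝ) := by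
        refine Finset.sum_le_sum fun i _ => ?_
        set x := V.starProjection (b i)
        have hx : x ∈ V := V.starProjection_apply_mem _
        have hxi : inner ℝ (b i) x = x i := by
          rw [EuclideanSpace.basisFun_apply, EuclideanSpace.inner_single_left]
          simp
        have hnorm : x i = ∑ j, |x j| ^ 2 := by
          have h1 : inner ℝ x x = inner ℝ (b i) x := by
            simp only [x]
            rw [V.inner_starProjection_left_eq_right, V.starProjection_eq_self_iff.2 hx]
          rw [← hxi, ← h1, real_inner_self_eq_norm_sq, EuclideanSpace.norm_sq_eq]
          simp
        change inner ℝ (b i) x ≤ _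
        rw [hxi]
        have h0 : 0 ≤ x i := by rw [hnorm]; positivity
        have hcs : (∑ j, |x j|) ^ 2 ≤ Fintype.card ι * x i := by
          rw [hnorm]
          exact sq_sum_le_card_mul_sum_sq
        have hbd : x i ^ 2 ≤ ε ^ 2 * (∑ j, |x j|) ^ 2 := by
          rw [← mul_pow, ← sq_abs (x i)]
          exact pow_le_pow_left₀ (abs_nonneg _) (hV x hx i) 2
        rcases h0.eq_or_lt with h | h
        · rw [← h]; positivity
        · refine le_of_mul_le_mul_right ?_ h
          nlinarith [mul_le_mul_of_nonneg_left hcs (sq_nonneg ε)]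
    _ = ε ^ 2 * (Fintype.card ι : ℝ) ^ 2 := by simp; ring

/-- Coordinates that are independent modulo a subspace. -/
theorem exists_finset_card_add_finrank (V : Submodule ℝ (EuclideanSpace ℝ ι)) :
    ∃ S : Finset ι, S.card + Module.finrank ℝ V = Fintype.card ι ∧
      ∀ v ∈ V, (∀ i ∉ S, v i = 0) → v = 0 := by
  classical
  set b := EuclideanSpace.basisFun ι ℝ
  -- Some of the images of the standard basis form a basis of the quotient by `V`; their indices
  -- make up `S`.
  obtain ⟨κ, a, ha, hspan, hind⟩ := exists_linearIndependent' ℝ (fun i => V.mkQ (b i))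
  have := Finite.of_injective a ha
  have := Fintype.ofFinite κ
  have htop : Submodule.span ℝ (Set.range fun i => V.mkQ (b i)) = ⊤ := by
    have h := b.toBasis.span_eq
    rw [OrthonormalBasis.coe_toBasis] at h
    rw [show (fun i => V.mkQ (b i)) = V.mkQ ∘ b from rfl, Set.range_comp, Submodule.span_image, h,
      Submodule.map_top, Submodule.range_mkQ]
  refine ⟨Finset.univ.image a, ?_, fun v hv h0 => ?_⟩
  · rw [Finset.card_image_of_injective _ ha, Finset.card_univ]
    have hd := Module.finrank_eq_card_basis (Module.Basis.mk hind (hspan.trans htop).ge)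
    rw [← hd, Submodule.finrank_quotient_add_finrank]
    simp
  · have hsum : v = ∑ k, v (a k) • b (a k) := by
      conv_lhs => rw [← b.sum_repr v]
      simp only [b, EuclideanSpace.basisFun_repr]
      rw [← Finset.sum_image (f := fun i => v i • (EuclideanSpace.basisFun ι ℝ) i)
        (g := a) (fun x _ y _ h => ha h)]
      refine (Finset.sum_subset (Finset.subset_univ _) fun i _ hi => ?_).symm
      rw [h0 i hi, zero_smul]
    have hz : ∑ k, v (a k) • ((fun i => V.mkQ (b i)) ∘ a) k = 0 := by
      have : V.mkQ v = 0 := by simpa using hv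
      rw [hsum, map_sum] at this
      simpa using this
    have hk := Fintype.linearIndependent_iff.1 hind _ hz
    rw [hsum]
    exact Finset.sum_eq_zero fun k _ => by rw [hk k, zero_smul]

/-- Many coordinates are independent modulo a lattice whose vectors have coordinates bounded by `ε`
times their `ℓ₁` norm. -/
theorem exists_independent_coordinates {L : AddSubgroup (ι → ℤ)} {ε : ℝ} (hε : 0 ≤ ε)
    (hL : ∀ y ∈ L, ∀ i, |(y i : ℝ)| ≤ ε * ∑ j, |(y j : ℝ)|) :
    ∃ S : Finset ι, (Fintype.card ι : ℝ) - ε ^ 2 * (Fintype.card ι : ℝ) ^ 2 ≤ S.card ∧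
      ∀ y ∈ L, (∀ i ∉ S, y i = 0) → y = 0 := by
  obtain ⟨S, hcard, hS⟩ := exists_finset_card_add_finrank (realSpan L)
  refine ⟨S, ?_, fun y hy h0 => ?_⟩
  · have h := finrank_le_of_abs_apply_le (realSpan L)
      fun v hv i => abs_apply_le_of_mem_realSpan hε hL hv i
    rw [← hcard] at h ⊢
    push_cast at h ⊢
    linarith
  · have h := hS (WithLp.toLp 2 fun i => (y i : ℝ)) (Submodule.subset_span ⟨y, hy, fun i => rfl⟩)
      fun i hi => by simp [h0 i hi]
    funext i
    have hi := congrArg (fun v : EuclideanSpace ℝ ι => v i) h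
    simpa using hi

end Lattices

/-! ### Counting configurations and choosing the parameters. -/

section LowerBound

variable {n : ℕ}

/-- Extension by zero from the first `k` coordinates. -/
def extendZero (k n : ℕ) : (Fin k → ℤ) →+ (Fin n → ℤ) where
  toFun y i := if h : (i : ℕ) < k then y ⟨i, h⟩ else 0
  map_zero' := by ext i; simp
  map_add' y z := by ext i; by_cases h : (i : ℕ) < k <;> simp [h]

theorem extendZero_castLE {k : ℕ} (hk : k ≤ n) (y : Fin k → ℤ) (i : Fin k) :
    extendZero k n y (Fin.castLE hk i) = y i := by
  simp [extendZero]

theorem sum_abs_extendZero {k : ℕ} (hk : k ≤ n) (y : Fin k → ℤ) :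
    ∑ j, |(extendZero k n y j : ℝ)| = ∑ j, |(y j : ℝ)| := by
  refine (Finset.sum_of_injOn (Fin.castLE hk) (Fin.castLE_injective hk).injOn (by simp) ?_ ?_).symm
  · intro i _ hi
    have : ¬ (i : ℕ) < k := fun h => hi ⟨⟨i, h⟩, by simp, by ext; simp⟩
    simp [extendZero, this]
  · intro i _
    rw [extendZero_castLE]

/-- A map that separates the box modulo a lattice of vectors with small coordinates takes many
values. -/
theorem exists_pow_le_ncard {X : Type*} {Y : Set X} (hY : Y.Finite) {L : AddSubgroup (Fin n → ℤ)}
    {ε : ℝ} (hε : 0 ≤ ε) (hL : ∀ x ∈ L, ∀ i, |(x i : ℝ)| ≤ ε * ∑ j, |(x j : ℝ)|) {m : ℕ}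
    (g : (Fin n → ℤ) → X) (hg : ∀ f, (∀ i, (f i).natAbs ≤ m) → g f ∈ Y ∧
      ∀ f', (∀ i, (f' i).natAbs ≤ m) → g f = g f' → f - f' ∈ L) {k : ℕ} (hk : k ≤ n) :
    ∃ d : ℕ, (k : ℝ) - ε ^ 2 * (k : ℝ) ^ 2 ≤ d ∧ (m + 1) ^ d ≤ Y.ncard := by
  classical
  obtain ⟨S, hS, hSL⟩ := exists_independent_coordinates (L := L.comap (extendZero k n)) hε
    fun y hy i => by
      have h := hL _ hy (Fin.castLE hk i)
      rwa [extendZero_castLE, sum_abs_extendZero hk] at h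
  refine ⟨S.card, by simpa using hS, ?_⟩
  -- Differences of these vectors are supported on `S`, so only the zero difference lies in the
  -- lattice.
  set F : (S → Fin (m + 1)) → Fin k → ℤ := fun u i => if h : i ∈ S then ((u ⟨i, h⟩ : ℕ) : ℤ) else 0
  have hbox : ∀ u i, (extendZero k n (F u) i).natAbs ≤ m := fun u i => by
    simp only [extendZero, AddMonoidHom.coe_mk, ZeroHom.coe_mk, F]
    split_ifs <;> (simp; try omega)
  have := hY.to_subtype
  have hinj : Function.Injective fun u : S → Fin (m + 1) =>
      (⟨g (extendZero k n (F u)), (hg _ (hbox u)).1⟩ : Y) := fun u u' h => by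
    have h1 := (hg _ (hbox u)).2 _ (hbox u') (Subtype.ext_iff.1 h)
    rw [← map_sub] at h1
    have h2 := hSL (F u - F u') h1 fun i hi => by simp [F, hi]
    funext i
    have h3 := congrFun (sub_eq_zero.1 h2) i
    simp only [F, i.2, dif_pos, Nat.cast_inj] at h3
    exact Fin.ext h3
  have hcard := Nat.card_le_card_of_injective _ hinj
  simpa [Nat.card_eq_fintype_card] using hcard

/-- A cell has three possible contents, not two; the factor `2` absorbs `log₂ 3`. -/
theorem logb_card_le_two_mul_effectiveSpace (A : StreamAutomaton n) {s N : ℕ} (hs : 1 ≤ s)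
    (hN0 : 0 < N) (hN : N ≤ Nat.card A.Q * (s * 3 ^ s)) :
    Real.logb 2 N ≤ 2 * A.effectiveSpace s := by
  have := A.finite_Q
  have : Nonempty A.Q := ⟨A.start⟩
  have hQ : (1 : ℝ) ≤ Nat.card A.Q := by exact_mod_cast Nat.card_pos (α := A.Q)
  have hs' : (1 : ℝ) ≤ s := by exact_mod_cast hs
  have h3 : Real.logb 2 3 ≤ 2 := by
    rw [Real.logb_le_iff_le_rpow (by norm_num) (by norm_num)]
    norm_num
  have hlogQ := Real.logb_nonneg (b := 2) (by norm_num) hQ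
  have hlogs := Real.logb_nonneg (b := 2) (by norm_num) hs'
  calc Real.logb 2 N ≤ Real.logb 2 (Nat.card A.Q * (s * 3 ^ s)) :=
        Real.logb_le_logb_of_le (by norm_num) (by exact_mod_cast hN0) (by exact_mod_cast hN)
    _ = Real.logb 2 (Nat.card A.Q) + (Real.logb 2 s + s * Real.logb 2 3) := by
        rw [Real.logb_mul (by positivity) (by positivity),
          Real.logb_mul (by positivity) (by positivity), Real.logb_pow]
    _ ≤ 2 * A.effectiveSpace s := by
        unfold StreamAutomaton.effectiveSpace
        nlinarith

/-- A number of coordinates of order `ε⁻²` that is small enough for the dimension bound. -/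
theorem exists_nat_coordinates {ε : ℝ} (hn : 1 ≤ n) (h1 : 1 / (24 * Real.sqrt (n : ℝ)) ≤ ε)
    (h2 : ε < 1 / 32) : ∃ k ≤ n, 1 / (1152 * ε ^ 2) ≤ (k : ℝ) ∧ ε ^ 2 * k ≤ 1 / 2 := by
  have hn0 : (0 : ℝ) < n := by exact_mod_cast hn
  have hsq : 0 < Real.sqrt (n : ℝ) := Real.sqrt_pos.2 hn0
  have hε : 0 < ε := lt_of_lt_of_le (by positivity) h1
  have hε2 : 0 < ε ^ 2 := by positivity
  -- The floor makes `ε² * k ≤ 1/2`; when `n` is the minimum, the lower bound on `ε` gives `n ≥ 1 /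
  -- (576 * ε²)`.
  refine ⟨min n ⌊1 / (2 * ε ^ 2)⌋₊, min_le_left _ _, ?_, ?_⟩
  · rw [Nat.cast_min, le_min_iff]
    constructor
    · have h3 : 1 ≤ ε * (24 * Real.sqrt n) := by rwa [div_le_iff₀ (by positivity)] at h1
      have h4 : 1 ≤ ε ^ 2 * (576 * n) := by
        have := pow_le_pow_left₀ zero_le_one h3 2
        rw [mul_pow, mul_pow, Real.sq_sqrt hn0.le] at this
        linarith
      rw [div_le_iff₀ (by positivity)]
      linarith
    · have h3 : 1 ≤ 1 / (2 * ε ^ 2) := by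
        rw [le_div_iff₀ (by positivity)]
        nlinarith
      have h4 := Nat.lt_floor_add_one (1 / (2 * ε ^ 2))
      have h5 : (1 : ℝ) ≤ ⌊1 / (2 * ε ^ 2)⌋₊ := by exact_mod_cast Nat.le_floor (by simpa using h3)
      have h6 : 1 / (1152 * ε ^ 2) = 1 / (2 * ε ^ 2) / 576 := by field_simp; norm_num
      rw [h6]
      linarith
  · have h3 : ((min n ⌊1 / (2 * ε ^ 2)⌋₊ : ℕ) : ℝ) ≤ 1 / (2 * ε ^ 2) :=
      (Nat.cast_le.2 (min_le_right _ _)).trans (Nat.floor_le (by positivity))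
    calc _ ≤ ε ^ 2 * (1 / (2 * ε ^ 2)) := by gcongr
      _ = 1 / 2 := by field_simp

end LowerBound

theorem mainTheorem2 :
    ∃ c : ℝ, 0 < c ∧ ∃ C : ℝ,
      ∀ (n : ℕ) (ε : ℝ), 1 ≤ n → 1 / (24 * Real.sqrt (n : ℝ)) ≤ ε → ε < 1 / 32 →
        ∀ (A : StreamAutomaton n) (dec : WorkTape → Fin n → ℝ), A.SolvesApproxFreq dec ε →
          ∀ m s : ℕ, 1 ≤ m → A.UsesSpace m s →
            c * (Real.logb 2 (m : ℝ) / ε ^ 2) - C * Real.logb 2 (n : ℝ) ≤ A.effectiveSpace s := by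
  -- `4608 = 1152 * 2 * 2`: one factor `2` for the coordinates lost to the lattice, one for the
  -- three-letter tape alphabet. No `log n` term is needed.
  refine ⟨1 / 4608, by norm_num, 0, fun n ε hn h1 h2 A dec hA m s hm hs => ?_⟩
  have hε : 0 < ε := by
    have : (0 : ℝ) < n := by exact_mod_cast hn
    exact lt_of_lt_of_le (by positivity) h1
  have hs1 : 1 ≤ s :=
    Nat.one_le_of_lt (hs [] (by simp [streamSize_nil]) _ StreamAutomaton.Reaches.nil).1
  obtain ⟨run, out, hrun, hcongr, hout⟩ := hA.exists_run
  obtain ⟨L, hL, g, hg⟩ := exists_lattice run hcongr out ε hout m (A.finite_fitsIn s)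
    fun σ hσ => hs σ hσ _ (hrun σ)
  obtain ⟨k, hkn, hk1, hk2⟩ := exists_nat_coordinates hn h1 h2
  obtain ⟨d, hd, hcard⟩ := exists_pow_le_ncard (A.finite_fitsIn s) hε.le hL g hg hkn
  have hspace := logb_card_le_two_mul_effectiveSpace A hs1 (N := (m + 1) ^ d) (by positivity)
    (hcard.trans (A.ncard_fitsIn_le s))
  have hm' : (1 : ℝ) ≤ m := by exact_mod_cast hm
  have hlog := Real.logb_nonneg (b := 2) (by norm_num) hm'
  have hmono : Real.logb 2 m ≤ Real.logb 2 (m + 1) :=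
    Real.logb_le_logb_of_le (by norm_num) (by positivity) (by linarith)
  have hd2 : 1 / (2304 * ε ^ 2) ≤ (d : ℝ) := by
    have h3 : ε ^ 2 * (k : ℝ) ^ 2 ≤ 1 / 2 * k := by
      rw [pow_two (k : ℝ), ← mul_assoc]
      gcongr
    have h4 : 1 / (2304 * ε ^ 2) = 1 / (1152 * ε ^ 2) / 2 := by field_simp; norm_num
    rw [h4]
    linarith
  push_cast at hspace
  rw [Real.logb_pow] at hspace
  have h5 : 1 / (2304 * ε ^ 2) * Real.logb 2 m ≤ d * Real.logb 2 (m + 1) := by gcongr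
  have h6 : 1 / 4608 * (Real.logb 2 m / ε ^ 2) = 1 / (2304 * ε ^ 2) * Real.logb 2 m / 2 := by
    field_simp
    ring
  rw [h6]
  linarith
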